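/- Let $d\ge 2$ and let $C\subset\mathbb{R}^d$ be a convex body, i.e. a compact convex set with nonempty interior. For an infinite discrete set $A\subset\mathbb{R}^d$, the arrangement $C+A$ is a packing if no two of the translates $C+a$ ($a\in A$) have a common interior point, and a covering if $C+A=\mathbb{R}^d$. Its upper density $\overline{\mathrm{den}}(C+A)$ and lower density $\underline{\mathrm{den}}(C+A)$ are the $\limsup$ and the $\liminf$, as $r\to\infty$, of $$\frac{\sum_{a\in A}\mathrm{vol}\big((C+a)\cap B^d(r)\big)}{\mathrm{vol}(B^d(r))},$$ where $B^d(r)$ is the Euclidean ball of radius $r$ centered at the origin. The translative packing density $\delta_T(C)$ is the supremum of $\overline{\mathrm{den}}(C+A)$ over all packings $C+A$, and the translative covering density $\theta_T(C)$ is the infimum of $\underline{\mathrm{den}}(C+A)$ over all coverings $C+A$. Call $C$ centrally symmetric if it is invariant under reflection in some point. Then the following hold. (1a) Suppose that either $0<\varepsilon\le \frac{1}{d^{d+1}}$, or $0<\varepsilon<1$ and $C$ is centrally symmetric. If $\delta_T(C)>1-\varepsilon$, then $$\theta_T(C)<\left(1+\varepsilon^{\frac{1}{d+1}}\right)^{d+1}.$$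 (1b) Suppose that $\frac{1}{d^{d+1}}<\varepsilon<1$ and $C$ is not centrally symmetric. If $\delta_T(C)>1-\varepsilon$, then $$\theta_T(C)<\left(1+\varepsilon d^d\right)\left(1+\frac1d\right)^d.$$ (2) Suppose that $0<\varepsilon<1$. If $\theta_T(C)<1+\varepsilon$, then $$\delta_T(C)>\left(1-\varepsilon^{\frac{1}{d+1}}\right)^{d+1}.$$ -/

import Mathlib

open scoped Pointwise

/-- `d`-dimensional Euclidean space. -/
abbrev Euc (d : ℕ) : Type := EuclideanSpace ℝ (Fin d)

/-- A `d`-dimensional convex body: a compact convex set with nonempty interior. -/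
structure IsBody {d : ℕ} (C : Set (Euc d)) : Prop where
  isCompact : IsCompact C
  convex : Convex ℝ C
  nonempty_interior : (interior C).Nonempty

/-- `C` is centrally symmetric: it is invariant under reflection in some point. -/
def IsCentrallySymmetric {d : ℕ} (C : Set (Euc d)) : Prop :=
  ∃ c : Euc d, Equiv.pointReflection c '' C = C

/-- The sets of translation vectors of arrangements: infinite discrete point sets. -/
structure IsTranslationSet {d : ℕ} (A : Set (Euc d)) : Prop where
  infinite : A.Infinite
  discrete : IsDiscrete A

/-- The arrangement `C + A` is a packing: no two of its translates of `C` have a common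
interior point. -/
structure IsPacking {d : ℕ} (C A : Set (Euc d)) : Prop extends IsTranslationSet A where
  disjoint : A.Pairwise fun a b => Disjoint (interior (a +ᵥ C)) (interior (b +ᵥ C))

/-- The arrangement `C + A` is a covering of the whole space. -/
structure IsCovering {d : ℕ} (C A : Set (Euc d)) : Prop extends IsTranslationSet A where
  cover : C + A = Set.univ

/-- The total volume of the parts of the translates `C + a`, `a ∈ A`, in the Euclidean ball of
radius `r` centered at the origin, divided by the volume of that ball. -/
noncomputable def ballDensity {d : ℕ} (C A : Set (Euc d)) (r : ℝ) : ENNReal :=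
  (∑' a : A, MeasureTheory.volume (((a : Euc d) +ᵥ C) ∩ Metric.closedBall 0 r)) /
    MeasureTheory.volume (Metric.closedBall (0 : Euc d) r)

/-- The upper density of the arrangement `C + A`. -/
noncomputable def upperDensity {d : ℕ} (C A : Set (Euc d)) : ENNReal :=
  Filter.limsup (ballDensity C A) Filter.atTop

/-- The lower density of the arrangement `C + A`. -/
noncomputable def lowerDensity {d : ℕ} (C A : Set (Euc d)) : ENNReal :=
  Filter.liminf (ballDensity C A) Filter.atTop

/-- The translative packing density `δ_T(C)`. -/
noncomputable def packingDensity {d : ℕ} (C : Set (Euc d)) : ENNReal :=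
  ⨆ (A : Set (Euc d)) (_ : IsPacking C A), upperDensity C A

/-- The translative covering density `θ_T(C)`. -/
noncomputable def coveringDensity {d : ℕ} (C : Set (Euc d)) : ENNReal :=
  ⨅ (A : Set (Euc d)) (_ : IsCovering C A), lowerDensity C A

/-!
The whole argument compares numbers of translates in large balls, for two bodies of different sizes
and one scale `0 < l ≤ 1`.

From packings to coverings (`coveringDensity_le_of_isPacking`): saturate a packing `C + A` of
density about `1 - ε` by non-overlapping translates `b - l • C`, `b ∈ B`, lying in its gaps. By
maximality, for every `x` the set `x - l • C` meets some `C + a` or some `b - l • C`, so `x` lies in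
`(1 + l) • C + a` or in `l • C - l • C + b`. A convex body satisfies `s - C ⊆ d • C` for some `s`
(`exists_sub_mem_natCast_smul`), and `s - C ⊆ C` if it is centrally symmetric. Hence `l • C - l • C`
lies in a translate of `(1 + l) • C`, provided that `l ≤ 1 / d` or that `C` is symmetric, and
`(1 + l) • C` covers space with density at most about `(1 + l) ^ d * (1 - ε + ε / l ^ d)`. The
scale is `l ^ (d + 1) = ε` for symmetric bodies and small `ε`, and `l = 1 / d` otherwise.

From coverings to packings (`le_packingDensity_of_isCovering`): in a covering `C + A` of density less
than `1 + ε`, choose a maximal `T ⊆ A` for which `(1 - l) • C + T` is a packing. If `a ∈ A` is not in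
`T`, then `(1 - l) • C + a` and some `(1 - l) • C + y`, `y ∈ T`, share a point `z`, and both `C + a`
and `C + y` contain `z + l • C`. So `C + a` covers at most the fraction `1 - l ^ d` of its volume
outside `C + T`, and the points of `A` outside `T` make up at most a density `ε / l ^ d`. What is
left has density at least `(1 - l) ^ d * (1 + ε - ε / l ^ d)`, and the scale is again
`l ^ (d + 1) = ε`.

Since the lower density of a covering and the upper density of a packing only have to be estimated
along some sequence of radii, it is enough to work at those radii where the given arrangement is
dense, respectively thin.
-/

open MeasureTheory Metric Filter Module

/-! ### Maximal conflict-free subsets -/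

theorem exists_maximal_pairwise {α : Type*} (S : Set α) (r : α → α → Prop) (hr : Std.Symm r) :
    ∃ T ⊆ S, T.Pairwise r ∧ ∀ x ∈ S, x ∉ T → ∃ y ∈ T, ¬ r x y := by
  obtain ⟨T, hT⟩ := zorn_subset {T : Set α | T ⊆ S ∧ T.Pairwise r} (by
    intro c hc hchain
    refine ⟨⋃₀ c, ⟨Set.sUnion_subset fun t ht => (hc ht).1, ?_⟩,
      fun t ht => Set.subset_sUnion_of_mem ht⟩
    exact (Set.pairwise_sUnion hchain.directedOn).2 fun t ht => (hc ht).2)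
  refine ⟨T, hT.prop.1, hT.prop.2, fun x hxS hxT => ?_⟩
  by_contra! hcon
  refine hxT (hT.le_of_ge (y := insert x T) ⟨Set.insert_subset hxS hT.prop.1, ?_⟩
    (Set.subset_insert x T) (Set.mem_insert x T))
  exact hT.prop.2.insert fun y hy _ => ⟨hcon y hy, hr.symm _ _ (hcon y hy)⟩

/-! ### Asymmetry of convex sets -/

section Convex

variable {E : Type*} [AddCommGroup E] [Module ℝ E]

theorem Convex.finset_sum_mem_card_smul {C : Set E} (hC : Convex ℝ C) (hne : C.Nonempty)
    {ι : Type*} (J : Finset ι) (f : ι → E) (hf : ∀ i ∈ J, f i ∈ C) :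
    ∑ i ∈ J, f i ∈ (J.card : ℝ) • C := by
  classical
  induction J using Finset.induction_on with
  | empty => simp [Set.zero_smul_set hne]
  | insert i J hi ih =>
    rw [Finset.sum_insert hi, Finset.card_insert_of_notMem hi, Nat.cast_succ, add_comm (J.card : ℝ),
      hC.add_smul zero_le_one (Nat.cast_nonneg _), one_smul]
    exact Set.add_mem_add (hf i (Finset.mem_insert_self _ _))
      (ih fun j hj => hf j (Finset.mem_insert_of_mem hj))

/-- Minkowski's bound on the asymmetry of a convex body: a translate of `-C` is contained in
`d • C`. By Helly's theorem it suffices to find a suitable translation for any `d + 1` points of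
`C`, and their sum is one. -/
theorem exists_sub_mem_natCast_smul {d : ℕ} {C : Set (Euc d)} (hC : IsBody C) :
    ∃ s : Euc d, ∀ y ∈ C, s - y ∈ (d : ℝ) • C := by
  classical
  obtain ⟨c, hc⟩ := hC.nonempty_interior.mono interior_subset
  have key : (⋂ y : C, ((y : Euc d) +ᵥ (d : ℝ) • C)).Nonempty := by
    refine Convex.helly_theorem_compact' (𝕜 := ℝ) (fun y => (hC.convex.smul _).vadd _)
      (fun y => (hC.isCompact.smul _).vadd _) fun I hI => ?_
    rw [finrank_euclideanSpace_fin] at hI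
    -- Fewer than `d + 1` points are padded by copies of `c`.
    refine ⟨∑ i ∈ I, (i : Euc d) + ((d : ℝ) + 1 - I.card) • c, ?_⟩
    simp only [Set.mem_iInter]
    intro i hi
    have h1 := hC.convex.finset_sum_mem_card_smul ⟨c, hc⟩ (I.erase i) (fun j => (j : Euc d))
      fun j _ => j.2
    have hcard : ((I.erase i).card : ℝ) = I.card - 1 := by
      rw [Finset.card_erase_of_mem hi, Nat.cast_sub (Finset.card_pos.2 ⟨i, hi⟩), Nat.cast_one]
    have hI' : (I.card : ℝ) ≤ d + 1 := by exact_mod_cast hI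
    have h2 : ((d : ℝ) + 1 - I.card) • c ∈ ((d : ℝ) + 1 - I.card) • C :=
      Set.smul_mem_smul_set hc
    have h3 := Set.add_mem_add h1 h2
    rw [← hC.convex.add_smul (Nat.cast_nonneg _) (by linarith), hcard,
      show (I.card : ℝ) - 1 + (d + 1 - I.card) = d by ring] at h3
    refine ⟨_, h3, ?_⟩
    simp only [vadd_eq_add]
    rw [← add_assoc, Finset.add_sum_erase I (fun j => (j : Euc d)) hi]
  obtain ⟨s, hs⟩ := key
  refine ⟨s, fun y hy => ?_⟩
  obtain ⟨z, hz, rfl⟩ := Set.mem_iInter.1 hs ⟨y, hy⟩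
  simpa [vadd_eq_add] using hz

/-- If a translate of `-C` lies in `m • C` and `l * m ≤ 1`, then a translate of `l • C - l • C`
lies in `(1 + l) • C`. -/
theorem Convex.exists_add_smul_sub_smul_mem {C : Set E} (hC : Convex ℝ C) {l m : ℝ} {s c : E}
    (hc : c ∈ C) (hl : 0 ≤ l) (hm : 0 ≤ m) (hlm : l * m ≤ 1) (hs : ∀ y ∈ C, s - y ∈ m • C) :
    ∃ t : E, ∀ x ∈ C, ∀ y ∈ C, t + l • x - l • y ∈ (1 + l) • C := by
  -- The summand `(1 - l * m) • c` fills up `(l + l * m) • C` to `(1 + l) • C`.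
  refine ⟨l • s + (1 - l * m) • c, fun x hx y hy => ?_⟩
  have h1 : l • (s - y) ∈ (l * m) • C := by
    rw [mul_smul]; exact Set.smul_mem_smul_set (hs y hy)
  have h2 : (1 - l * m) • c ∈ (1 - l * m) • C := Set.smul_mem_smul_set hc
  have h3 : l • x ∈ l • C := Set.smul_mem_smul_set hx
  have h4 := Set.add_mem_add (Set.add_mem_add h1 h2) h3
  rw [← hC.add_smul (mul_nonneg hl hm) (by linarith), add_sub_cancel,
    ← hC.add_smul zero_le_one hl] at h4
  convert h4 using 1
  module

end Convex

/-! ### Volumes and counting in balls -/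

section Body

variable {d : ℕ} {C D : Set (Euc d)}

theorem IsBody.smul (hC : IsBody C) {c : ℝ} (hc : c ≠ 0) : IsBody (c • C) where
  isCompact := hC.isCompact.smul c
  convex := hC.convex.smul c
  nonempty_interior := by
    rw [interior_smul₀ hc]
    exact hC.nonempty_interior.smul_set

theorem IsBody.vadd (hC : IsBody C) (x : Euc d) : IsBody (x +ᵥ C) where
  isCompact := hC.isCompact.vadd x
  convex := hC.convex.vadd x
  nonempty_interior := by
    rw [interior_vadd]
    exact hC.nonempty_interior.vadd_set

theorem IsBody.volume_pos (hC : IsBody C) : 0 < volume C :=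
  Measure.measure_pos_of_nonempty_interior _ hC.nonempty_interior

theorem IsBody.volume_ne_top (hC : IsBody C) : volume C ≠ ⊤ := hC.isCompact.measure_ne_top

theorem IsBody.volume_interior (hC : IsBody C) : volume (interior C) = volume C :=
  measure_congr (interior_ae_eq_of_null_frontier (hC.convex.addHaar_frontier _))

theorem IsBody.real_volume_pos (hC : IsBody C) : 0 < volume.real C :=
  ENNReal.toReal_pos hC.volume_pos.ne' hC.volume_ne_top

theorem real_volume_smul (c : ℝ) (C : Set (Euc d)) :
    volume.real (c • C) = |c| ^ d * volume.real C := by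
  rw [measureReal_def, Measure.addHaar_smul, ENNReal.toReal_mul, finrank_euclideanSpace_fin,
    ENNReal.toReal_ofReal (abs_nonneg _), abs_pow, measureReal_def]

theorem real_volume_vadd (x : Euc d) (C : Set (Euc d)) :
    volume.real (x +ᵥ C) = volume.real C := by
  rw [measureReal_def, measure_vadd, measureReal_def]

theorem real_volume_closedBall {r : ℝ} (hr : 0 ≤ r) :
    volume.real (closedBall (0 : Euc d) r) = r ^ d * volume.real (closedBall (0 : Euc d) 1) := by
  rw [Measure.addHaar_real_closedBall' _ _ hr, finrank_euclideanSpace_fin]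

theorem real_volume_closedBall_pos {r : ℝ} (hr : 0 < r) :
    0 < volume.real (closedBall (0 : Euc d) r) :=
  ENNReal.toReal_pos (measure_closedBall_pos _ _ hr).ne' measure_closedBall_lt_top.ne

/-- Two finite families of translates of convex bodies that lie in a ball and have pairwise
disjoint interiors do not exceed the ball in total volume. -/
theorem card_mul_volume_add_le (hC : IsBody C) (hD : IsBody D) {F G : Finset (Euc d)} {ρ : ℝ}
    (hF : (F : Set (Euc d)).Pairwise fun a b => Disjoint (interior (a +ᵥ C)) (interior (b +ᵥ C)))
    (hG : (G : Set (Euc d)).Pairwise fun a b => Disjoint (interior (a +ᵥ D)) (interior (b +ᵥ D)))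
    (hFG : ∀ a ∈ F, ∀ b ∈ G, Disjoint (interior (a +ᵥ C)) (interior (b +ᵥ D)))
    (hFρ : ∀ a ∈ F, a +ᵥ C ⊆ closedBall 0 ρ) (hGρ : ∀ b ∈ G, b +ᵥ D ⊆ closedBall 0 ρ) :
    F.card * volume.real C + G.card * volume.real D
      ≤ volume.real (closedBall (0 : Euc d) ρ) := by
  have hvol : ∀ {K : Set (Euc d)} (_ : IsBody K) (H : Finset (Euc d)),
      (H : Set (Euc d)).Pairwise (fun a b => Disjoint (interior (a +ᵥ K)) (interior (b +ᵥ K))) →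
      volume (⋃ a ∈ H, interior (a +ᵥ K)) = ENNReal.ofReal (H.card * volume.real K) := by
    intro K hK H hH
    rw [measure_biUnion_finset hH fun a _ => isOpen_interior.measurableSet]
    simp_rw [(hK.vadd _).volume_interior, measure_vadd]
    rw [Finset.sum_const, nsmul_eq_mul, ENNReal.ofReal_mul (Nat.cast_nonneg _),
      ENNReal.ofReal_natCast, measureReal_def, ENNReal.ofReal_toReal hK.volume_ne_top]
  have hdisj : Disjoint (⋃ a ∈ F, interior (a +ᵥ C)) (⋃ b ∈ G, interior (b +ᵥ D)) := by
    simp only [Set.disjoint_iUnion_left, Set.disjoint_iUnion_right]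
    exact fun b hb a ha => hFG a ha b hb
  have hmeas : MeasurableSet (⋃ b ∈ G, interior (b +ᵥ D)) :=
    (isOpen_biUnion fun b _ => isOpen_interior).measurableSet
  have hsub : (⋃ a ∈ F, interior (a +ᵥ C)) ∪ (⋃ b ∈ G, interior (b +ᵥ D))
      ⊆ closedBall 0 ρ :=
    Set.union_subset (Set.iUnion₂_subset fun a ha => interior_subset.trans (hFρ a ha))
      (Set.iUnion₂_subset fun b hb => interior_subset.trans (hGρ b hb))
  have h := measure_mono (μ := volume) hsub
  rw [measure_union hdisj hmeas, hvol hC F hF, hvol hD G hG,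
    ← ENNReal.ofReal_add (by positivity) (by positivity)] at h
  exact (ENNReal.ofReal_le_iff_le_toReal measure_closedBall_lt_top.ne).1 h

theorem vadd_subset_closedBall {R : ℝ} (hK : C ⊆ closedBall 0 R) {x : Euc d} {ρ σ : ℝ}
    (hx : x ∈ closedBall 0 ρ) (h : ρ + R ≤ σ) : x +ᵥ C ⊆ closedBall 0 σ := by
  rintro _ ⟨k, hk, rfl⟩
  have h1 := hK hk
  rw [mem_closedBall_zero_iff] at *
  exact (norm_add_le _ _).trans (by linarith)

theorem mem_closedBall_of_vadd_inter_nonempty {R : ℝ} (hK : C ⊆ closedBall 0 R) {x : Euc d}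
    {ρ σ : ℝ} (hx : ((x +ᵥ C) ∩ closedBall 0 ρ).Nonempty) (h : ρ + R ≤ σ) :
    x ∈ closedBall 0 σ := by
  obtain ⟨_, ⟨k, hk, rfl⟩, h2⟩ := hx
  have h1 := hK hk
  simp only [mem_closedBall_zero_iff, vadd_eq_add] at *
  have h3 := norm_sub_le (x + k) k
  rw [add_sub_cancel_right] at h3
  linarith

/-- Only finitely many translates in a packing are centered in a given ball. -/
theorem finite_inter_closedBall_of_pairwise_disjoint (hC : IsBody C) {A : Set (Euc d)}
    (hA : A.Pairwise fun a b => Disjoint (interior (a +ᵥ C)) (interior (b +ᵥ C))) (r : ℝ) :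
    (A ∩ closedBall 0 r).Finite := by
  obtain ⟨R, hR⟩ := hC.isCompact.isBounded.subset_closedBall 0
  by_contra hinf
  obtain ⟨n, hn⟩ := exists_nat_gt (volume.real (closedBall (0 : Euc d) (r + R)) / volume.real C)
  obtain ⟨F, hF, hcard⟩ := Set.Infinite.exists_subset_card_eq hinf n
  have h := card_mul_volume_add_le hC hC (F := F) (G := ∅) (ρ := r + R)
    (hA.mono fun a ha => (hF ha).1) (by simp) (by simp)
    (fun a ha => vadd_subset_closedBall hR (hF ha).2 le_rfl) (by simp)
  rw [hcard, Finset.card_empty, Nat.cast_zero, zero_mul, add_zero] at h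
  rw [div_lt_iff₀ hC.real_volume_pos] at hn
  linarith

theorem isDiscrete_of_finite_inter_closedBall {A : Set (Euc d)}
    (hA : ∀ r, (A ∩ closedBall 0 r).Finite) : IsDiscrete A := by
  refine isDiscrete_iff_nhdsWithin.2 fun x hx => ?_
  have hnhds : closedBall (0 : Euc d) (‖x‖ + 1) ∈ nhds x :=
    Filter.mem_of_superset (ball_mem_nhds x one_pos) fun y hy => by
      rw [mem_ball, dist_eq_norm] at hy
      rw [mem_closedBall_zero_iff]
      have := norm_add_le (y - x) x
      rw [sub_add_cancel] at this
      linarith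
  rw [← nhdsWithin_inter_of_mem' (mem_nhdsWithin_of_mem_nhds hnhds)]
  exact (hA (‖x‖ + 1)).isDiscrete.nhdsWithin x ⟨hx, by simp⟩

end Body

/-! ### Ball densities: point counts and scaling -/

section Density

variable {d : ℕ} {C : Set (Euc d)}

theorem tsum_volume_le_card_mul {A : Set (Euc d)} {F : Finset (Euc d)} {r : ℝ}
    (hF : ∀ x ∈ A, ((x +ᵥ C) ∩ closedBall 0 r).Nonempty → x ∈ F) :
    ∑' a : A, volume (((a : Euc d) +ᵥ C) ∩ closedBall 0 r) ≤ F.card * volume C := by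
  rw [tsum_subtype A fun a => volume ((a +ᵥ C) ∩ closedBall 0 r)]
  rw [tsum_eq_sum (s := F)]
  · rw [← nsmul_eq_mul]
    refine Finset.sum_le_card_nsmul _ _ _ fun x _ => ?_
    refine (Set.indicator_le_self' (fun _ _ => zero_le) x).trans ?_
    exact (measure_mono Set.inter_subset_left).trans (measure_vadd _ _ _).le
  · intro x hx
    by_cases hxA : x ∈ A
    · rw [Set.indicator_of_mem hxA, Set.not_nonempty_iff_eq_empty.1 fun h => hx (hF x hxA h),
        measure_empty]
    · exact Set.indicator_of_notMem hxA _

theorem card_mul_le_tsum_volume {A : Set (Euc d)} {F : Finset (Euc d)} {r : ℝ}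
    (hFA : ↑F ⊆ A) (hF : ∀ x ∈ F, x +ᵥ C ⊆ closedBall 0 r) :
    F.card * volume C ≤ ∑' a : A, volume (((a : Euc d) +ᵥ C) ∩ closedBall 0 r) := by
  rw [tsum_subtype A fun a => volume ((a +ᵥ C) ∩ closedBall 0 r)]
  refine le_trans ?_ (ENNReal.sum_le_tsum F)
  rw [← nsmul_eq_mul]
  refine Finset.card_nsmul_le_sum _ _ _ fun x hx => ?_
  rw [Set.indicator_of_mem (hFA hx), Set.inter_eq_left.2 (hF x hx), measure_vadd]

theorem ballDensity_le_of_card {A : Set (Euc d)} {F : Finset (Euc d)} {r M : ℝ}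
    (hC : volume C ≠ ⊤) (hF : ∀ x ∈ A, ((x +ᵥ C) ∩ closedBall 0 r).Nonempty → x ∈ F)
    (h : F.card * volume.real C ≤ M * volume.real (closedBall (0 : Euc d) r)) :
    ballDensity C A r ≤ ENNReal.ofReal M := by
  refine ENNReal.div_le_of_le_mul ((tsum_volume_le_card_mul hF).trans ?_)
  have h1 := ENNReal.ofReal_le_ofReal h
  rw [ENNReal.ofReal_mul (Nat.cast_nonneg _), ENNReal.ofReal_natCast,
    ENNReal.ofReal_mul' (by positivity), measureReal_def, measureReal_def,
    ENNReal.ofReal_toReal hC, ENNReal.ofReal_toReal measure_closedBall_lt_top.ne] at h1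
  exact h1

theorem le_ballDensity_of_card {A : Set (Euc d)} {F : Finset (Euc d)} {r M : ℝ} (hr : 0 < r)
    (hC : volume C ≠ ⊤) (hFA : ↑F ⊆ A) (hF : ∀ x ∈ F, x +ᵥ C ⊆ closedBall 0 r)
    (h : M * volume.real (closedBall (0 : Euc d) r) ≤ F.card * volume.real C) :
    ENNReal.ofReal M ≤ ballDensity C A r := by
  refine (ENNReal.le_div_iff_mul_le (Or.inl (measure_closedBall_pos _ _ hr).ne')
    (Or.inl measure_closedBall_lt_top.ne)).2 (le_trans ?_ (card_mul_le_tsum_volume hFA hF))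
  have h1 := ENNReal.ofReal_le_ofReal h
  rw [ENNReal.ofReal_mul (Nat.cast_nonneg _), ENNReal.ofReal_natCast,
    ENNReal.ofReal_mul' (by positivity), measureReal_def, measureReal_def,
    ENNReal.ofReal_toReal hC, ENNReal.ofReal_toReal measure_closedBall_lt_top.ne] at h1
  exact h1

theorem lt_card_of_lt_ballDensity {A : Set (Euc d)} {F : Finset (Euc d)} {r M : ℝ}
    (hC : volume C ≠ ⊤) (hF : ∀ x ∈ A, ((x +ᵥ C) ∩ closedBall 0 r).Nonempty → x ∈ F)
    (h : ENNReal.ofReal M < ballDensity C A r) :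
    M * volume.real (closedBall (0 : Euc d) r) < F.card * volume.real C := by
  by_contra! hcon
  exact h.not_ge (ballDensity_le_of_card hC hF hcon)

theorem card_lt_of_ballDensity_lt {A : Set (Euc d)} {F : Finset (Euc d)} {r M : ℝ} (hr : 0 < r)
    (hC : volume C ≠ ⊤) (hFA : ↑F ⊆ A) (hF : ∀ x ∈ F, x +ᵥ C ⊆ closedBall 0 r)
    (h : ballDensity C A r < ENNReal.ofReal M) :
    F.card * volume.real C < M * volume.real (closedBall (0 : Euc d) r) := by
  by_contra! hcon
  exact h.not_ge (le_ballDensity_of_card hr hC hFA hF hcon)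

theorem smul_set_vadd (s : ℝ) (x : Euc d) (C : Set (Euc d)) :
    s • (x +ᵥ C) = (s • x) +ᵥ s • C := by
  ext y
  simp only [Set.mem_vadd_set, Set.mem_smul_set, vadd_eq_add]
  constructor
  · rintro ⟨_, ⟨z, hz, rfl⟩, rfl⟩
    exact ⟨_, ⟨z, hz, rfl⟩, (smul_add _ _ _).symm⟩
  · rintro ⟨_, ⟨z, hz, rfl⟩, rfl⟩
    exact ⟨_, ⟨z, hz, rfl⟩, smul_add _ _ _⟩

theorem ballDensity_smul {s : ℝ} (hs : 0 < s) (C A : Set (Euc d)) (r : ℝ) :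
    ballDensity (s • C) (s • A) (s * r) = ballDensity C A r := by
  have hball : closedBall (0 : Euc d) (s * r) = s • closedBall 0 r := by
    rw [smul_closedBall' hs.ne', smul_zero, Real.norm_of_nonneg hs.le]
  have hscale : ENNReal.ofReal |s ^ finrank ℝ (Euc d)| ≠ 0 := by
    rw [ENNReal.ofReal_ne_zero_iff]; positivity
  unfold ballDensity
  rw [hball, Measure.addHaar_smul]
  have hsum : ∑' a : ↑(s • A), volume (((a : Euc d) +ᵥ s • C) ∩ s • closedBall 0 r)
      = ENNReal.ofReal |s ^ finrank ℝ (Euc d)| *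
        ∑' a : A, volume (((a : Euc d) +ᵥ C) ∩ closedBall 0 r) := by
    rw [← ENNReal.tsum_mul_left]
    have hinj : Set.InjOn (fun x : Euc d => s • x) A := (smul_right_injective _ hs.ne').injOn
    refine (tsum_image (f := fun a => volume ((a +ᵥ s • C) ∩ s • closedBall 0 r)) hinj).trans ?_
    refine tsum_congr fun a => ?_
    rw [← Measure.addHaar_smul, Set.smul_set_inter₀ hs.ne']
    congr 2
    exact (smul_set_vadd s _ C).symm
  rw [hsum, ENNReal.mul_div_mul_left _ _ hscale ENNReal.ofReal_ne_top]

theorem frequently_ballDensity_inv_smul {s : ℝ} (hs : 0 < s) {C A : Set (Euc d)}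
    {p : ENNReal → Prop} (h : ∃ᶠ r in atTop, p (ballDensity (s • C) A r)) :
    ∃ᶠ r in atTop, p (ballDensity C (s⁻¹ • A) r) := by
  have ht : Tendsto (fun r : ℝ => s⁻¹ * r) atTop atTop :=
    tendsto_id.const_mul_atTop (inv_pos.2 hs)
  refine ht.frequently (h.mono fun r hr => ?_)
  have := ballDensity_smul hs C (s⁻¹ • A) (s⁻¹ * r)
  rw [smul_inv_smul₀ hs.ne', mul_inv_cancel_left₀ hs.ne'] at this
  rwa [← this]

theorem IsTranslationSet.smul {A : Set (Euc d)} (hA : IsTranslationSet A) {s : ℝ} (hs : s ≠ 0) :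
    IsTranslationSet (s • A) where
  infinite := hA.infinite.image (smul_right_injective _ hs).injOn
  discrete := hA.discrete.image (Homeomorph.smulOfNeZero s hs).isInducing

theorem IsCovering.inv_smul {A : Set (Euc d)} {s : ℝ} (hs : s ≠ 0)
    (h : IsCovering (s • C) A) : IsCovering C (s⁻¹ • A) where
  toIsTranslationSet := h.toIsTranslationSet.smul (inv_ne_zero hs)
  cover := by
    have := congrArg (s⁻¹ • ·) h.cover
    simpa [smul_add, smul_smul, inv_mul_cancel₀ hs, Set.smul_set_univ₀ (inv_ne_zero hs)]
      using this

theorem IsPacking.inv_smul {A : Set (Euc d)} {s : ℝ} (hs : s ≠ 0)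
    (h : IsPacking (s • C) A) : IsPacking C (s⁻¹ • A) where
  toIsTranslationSet := h.toIsTranslationSet.smul (inv_ne_zero hs)
  disjoint := by
    rintro _ ⟨a, ha, rfl⟩ _ ⟨b, hb, rfl⟩ hab
    have hdis := h.disjoint ha hb (fun h => hab (by rw [h]))
    have key : ∀ x : Euc d, x +ᵥ s • C = s • ((s⁻¹ • x) +ᵥ C) := fun x => by
      rw [smul_set_vadd, smul_inv_smul₀ hs]
    dsimp only at hdis
    rw [key, key, interior_smul₀ hs, interior_smul₀ hs] at hdis
    exact (Set.disjoint_image_iff (smul_right_injective _ hs)).1 hdis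

end Density

/-! ### Growth of balls -/
theorem tendsto_one_add_div_pow (c : ℝ) (d : ℕ) :
    Tendsto (fun r : ℝ => (1 + c / r) ^ d) atTop (nhds 1) := by
  have h : Tendsto (fun r : ℝ => c / r) atTop (nhds 0) := tendsto_const_nhds.div_atTop tendsto_id
  simpa using (h.const_add 1).pow d

theorem real_volume_closedBall_add {d : ℕ} {r c : ℝ} (hr : 0 < r) (hrc : 0 ≤ r + c) :
    volume.real (closedBall (0 : Euc d) (r + c))
      = (1 + c / r) ^ d * volume.real (closedBall (0 : Euc d) r) := by
  rw [real_volume_closedBall hrc, real_volume_closedBall hr.le, ← mul_assoc, ← mul_pow]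
  congr 2
  field_simp

/-! ### Thin coverings from dense packings -/

section Main

variable {d : ℕ} {C : Set (Euc d)}

/-- A packing can be saturated by translates of a second body `D`. -/
theorem exists_saturating_set {D : Set (Euc d)} (hD : (interior D).Nonempty) (A : Set (Euc d)) :
    ∃ B : Set (Euc d),
      B.Pairwise (fun a b : Euc d => Disjoint (interior (a +ᵥ D)) (interior (b +ᵥ D))) ∧
      (∀ a ∈ A, ∀ b ∈ B, Disjoint (interior (a +ᵥ C)) (interior (b +ᵥ D))) ∧
      ∀ x : Euc d, (∃ a ∈ A, ¬ Disjoint (interior (x +ᵥ D)) (interior (a +ᵥ C))) ∨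
        ∃ b ∈ B, ¬ Disjoint (interior (x +ᵥ D)) (interior (b +ᵥ D)) := by
  obtain ⟨B, hBS, hB, hmax⟩ := exists_maximal_pairwise
    {x : Euc d | ∀ a ∈ A, Disjoint (interior (a +ᵥ C)) (interior (x +ᵥ D))}
    (fun a b : Euc d => Disjoint (interior (a +ᵥ D)) (interior (b +ᵥ D))) ⟨fun _ _ h => h.symm⟩
  refine ⟨B, hB, fun a ha b hb => hBS hb a ha, fun x => ?_⟩
  by_cases hxS : ∀ a ∈ A, Disjoint (interior (a +ᵥ C)) (interior (x +ᵥ D))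
  · right
    -- A point of `B` overlaps itself, because the interior of `D` is nonempty.
    by_cases hxB : x ∈ B
    · refine ⟨x, hxB, fun h => ?_⟩
      rw [disjoint_self, interior_vadd] at h
      exact hD.vadd_set.ne_empty h
    · exact hmax x hxS hxB
  · left
    push Not at hxS
    obtain ⟨a, ha, h⟩ := hxS
    exact ⟨a, ha, fun h' => h h'.symm⟩

/-- A dense packing yields a thin covering. Saturate the packing `C + A` by translates
`b - l • C`. A point `x` is then covered by `(1 + l) • C + a` if `x - l • C` meets `C + a`, and by
`(1 + l) • C + (b - t)` if `x - l • C` meets `b - l • C`. The translates `b - l • C` lie in the gaps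
of the packing, which bounds their number. -/
theorem coveringDensity_le_of_isPacking (hC : IsBody C) {A : Set (Euc d)} (hA : IsPacking C A)
    {l δ M : ℝ} {t : Euc d} (hl : 0 < l) (hl1 : l ≤ 1)
    (ht : ∀ x ∈ C, ∀ y ∈ C, t + l • x - l • y ∈ (1 + l) • C)
    (hδ : ENNReal.ofReal δ < upperDensity C A)
    (hM : (1 + l) ^ d * (δ + (1 - δ) / l ^ d) < M) :
    coveringDensity C ≤ ENNReal.ofReal M := by
  classical
  set D : Set (Euc d) := (-l) • C with hDdef
  have hD : IsBody D := hC.smul (neg_ne_zero.2 hl.ne')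
  have hl' : 0 < 1 + l := by linarith
  obtain ⟨B, hB, hAB, hsat⟩ := exists_saturating_set (C := C) hD.nonempty_interior A
  have hfinA := finite_inter_closedBall_of_pairwise_disjoint hC hA.disjoint
  have hfinB := finite_inter_closedBall_of_pairwise_disjoint hD hB
  obtain ⟨R, hR0, hR⟩ := (((hC.isCompact.union hD.isCompact).union
    (hC.isCompact.smul (1 + l))).union (isCompact_singleton (x := t))).isBounded.subset_closedBall_lt
      0 0
  have hRC : C ⊆ closedBall 0 R := fun x hx => hR (Or.inl (Or.inl (Or.inl hx)))
  have hRD : D ⊆ closedBall 0 R := fun x hx => hR (Or.inl (Or.inl (Or.inr hx)))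
  have hRK : (1 + l) • C ⊆ closedBall 0 R := fun x hx => hR (Or.inl (Or.inr hx))
  have hRt : ‖t‖ ≤ R := mem_closedBall_zero_iff.1 (hR (Or.inr rfl))
  -- The translation by `t` lets the same body `(1 + l) • C` serve for both kinds of points.
  set S : Set (Euc d) := A ∪ (fun b => b - t) '' B with hS
  have hSsub : ∀ r, S ∩ closedBall 0 r ⊆
      (A ∩ closedBall 0 (r + R)) ∪ (fun b => b - t) '' (B ∩ closedBall 0 (r + R)) := by
    rintro r x ⟨hx | ⟨b, hb, rfl⟩, hxr⟩
    · exact Or.inl ⟨hx, closedBall_subset_closedBall (by linarith) hxr⟩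
    · refine Or.inr ⟨b, ⟨hb, ?_⟩, rfl⟩
      rw [mem_closedBall_zero_iff] at hxr ⊢
      have := norm_add_le (b - t) t
      rw [sub_add_cancel] at this
      linarith
  have hcov : IsCovering ((1 + l) • C) S := by
    refine ⟨⟨hA.infinite.mono Set.subset_union_left, isDiscrete_of_finite_inter_closedBall fun r =>
      ((hfinA _).union ((hfinB _).image _)).subset (hSsub r)⟩, Set.eq_univ_of_forall fun x => ?_⟩
    rcases hsat x with ⟨a, ha, h⟩ | ⟨b, hb, h⟩
    · obtain ⟨_, h1, h2⟩ := Set.not_disjoint_iff.1 h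
      obtain ⟨_, ⟨u, hu, rfl⟩, h1⟩ := interior_subset h1
      obtain ⟨v, hv, rfl⟩ := interior_subset h2
      simp only [vadd_eq_add] at h1
      refine ⟨v + l • u, ?_, a, Or.inl ha, ?_⟩
      · rw [hC.convex.add_smul zero_le_one hl.le, one_smul]
        exact Set.add_mem_add hv (Set.smul_mem_smul_set hu)
      · rw [eq_sub_of_add_eq h1]
        module
    · obtain ⟨_, h1, h2⟩ := Set.not_disjoint_iff.1 h
      obtain ⟨_, ⟨u, hu, rfl⟩, h1⟩ := interior_subset h1
      obtain ⟨_, ⟨v, hv, rfl⟩, rfl⟩ := interior_subset h2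
      simp only [vadd_eq_add] at h1
      refine ⟨_, ht u hu v hv, b - t, Or.inr ⟨b, hb, rfl⟩, ?_⟩
      rw [eq_sub_of_add_eq h1]
      module
  refine (iInf₂_le _ (hcov.inv_smul hl'.ne')).trans (liminf_le_of_frequently_le'
    (frequently_ballDensity_inv_smul hl' (p := fun y => y ≤ ENNReal.ofReal M) ?_))
  have hlim : Tendsto (fun r : ℝ => (1 + l) ^ d *
      (δ * (1 - 1 / l ^ d) + (1 + 3 * R / r) ^ d / l ^ d)) atTop
      (nhds ((1 + l) ^ d * (δ * (1 - 1 / l ^ d) + 1 / l ^ d))) :=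
    (((tendsto_one_add_div_pow (3 * R) d).div_const _).const_add _).const_mul _
  have hM' : (1 + l) ^ d * (δ * (1 - 1 / l ^ d) + 1 / l ^ d) < M := by
    convert hM using 2
    ring
  refine ((frequently_lt_of_lt_limsup (h := hδ)).and_eventually
    ((hlim.eventually_lt_const hM').and (eventually_gt_atTop 0))).mono ?_
  rintro r ⟨hdens, hrM, hr0⟩
  -- The radius `r + 2 * R` captures every translate of the covering that meets the ball of radius
  -- `r`: one `R` accounts for the size of the body, the other for the translation by `t`.
  set F := (hfinA (r + 2 * R)).toFinset with hF
  set G := (hfinB (r + 2 * R)).toFinset with hG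
  have hFG := card_mul_volume_add_le hC hD (F := F) (G := G) (ρ := r + 3 * R)
    (hA.disjoint.mono fun x hx => ((hfinA _).mem_toFinset.1 hx).1)
    (hB.mono fun x hx => ((hfinB _).mem_toFinset.1 hx).1)
    (fun a ha b hb => hAB a ((hfinA _).mem_toFinset.1 ha).1 b ((hfinB _).mem_toFinset.1 hb).1)
    (fun x hx => vadd_subset_closedBall hRC ((hfinA _).mem_toFinset.1 hx).2 (by linarith))
    (fun x hx => vadd_subset_closedBall hRD ((hfinB _).mem_toFinset.1 hx).2 (by linarith))
  rw [real_volume_closedBall_add hr0 (by linarith), hDdef, real_volume_smul, abs_neg,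
    abs_of_pos hl] at hFG
  have hFδ := lt_card_of_lt_ballDensity (F := F) hC.volume_ne_top (fun x hx hne =>
    (hfinA _).mem_toFinset.2 ⟨hx, mem_closedBall_of_vadd_inter_nonempty hRC hne (by linarith)⟩) hdens
  have hW := real_volume_closedBall_pos (d := d) hr0
  set W := volume.real (closedBall (0 : Euc d) r)
  set V := volume.real C
  refine ballDensity_le_of_card (F := F ∪ G.image fun b => b - t)
    (hC.smul hl'.ne').volume_ne_top ?_ ?_
  · intro x hx hne
    rcases hSsub (r + R) ⟨hx, mem_closedBall_of_vadd_inter_nonempty hRK hne le_rfl⟩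
      with h | ⟨b, hb, rfl⟩
    · rw [show r + R + R = r + 2 * R by ring] at h
      exact Finset.mem_union_left _ ((hfinA _).mem_toFinset.2 h)
    · rw [show r + R + R = r + 2 * R by ring] at hb
      exact Finset.mem_union_right _ (Finset.mem_image_of_mem _ ((hfinB _).mem_toFinset.2 hb))
  · have hcard : ((F ∪ G.image fun b => b - t).card : ℝ) ≤ F.card + G.card := by
      exact_mod_cast (Finset.card_union_le _ _).trans
        (Nat.add_le_add_left Finset.card_image_le _)
    rw [real_volume_smul, abs_of_pos hl']
    have hV : 0 < V := hC.real_volume_pos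
    have hld : 0 < l ^ d := pow_pos hl d
    -- Trading a gap filler for a translate of `C` lowers the count, so the worst case is the least
    -- possible density `δ` of the packing.
    have hinv : 1 - 1 / l ^ d ≤ 0 := by
      rw [sub_nonpos, le_div_iff₀ hld, one_mul]
      exact pow_le_one₀ hl.le hl1
    have h1 : (G.card : ℝ) * V ≤ ((1 + 3 * R / r) ^ d * W - F.card * V) / l ^ d := by
      rw [le_div_iff₀ hld]
      linarith
    have h2 := mul_le_mul_of_nonpos_right hFδ.le hinv
    calc _ ≤ ((F.card : ℝ) + G.card) * ((1 + l) ^ d * V) := by gcongr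
      _ = (1 + l) ^ d * (F.card * V + G.card * V) := by ring
      _ ≤ (1 + l) ^ d * (F.card * V + ((1 + 3 * R / r) ^ d * W - F.card * V) / l ^ d) := by gcongr
      _ = (1 + l) ^ d * (F.card * V * (1 - 1 / l ^ d) + (1 + 3 * R / r) ^ d / l ^ d * W) := by ring
      _ ≤ (1 + l) ^ d * (δ * W * (1 - 1 / l ^ d) + (1 + 3 * R / r) ^ d / l ^ d * W) := by gcongr
      _ = (1 + l) ^ d * (δ * (1 - 1 / l ^ d) + (1 + 3 * R / r) ^ d / l ^ d) * W := by ring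
      _ ≤ M * W := by gcongr

/-! ### Dense packings from thin coverings -/

/-- An arrangement of finite lower density has only finitely many translates centered in a given
ball. -/
theorem finite_inter_closedBall_of_lowerDensity_ne_top (hC : IsBody C) {A : Set (Euc d)}
    (h : lowerDensity C A < ⊤) (ρ : ℝ) : (A ∩ closedBall 0 ρ).Finite := by
  obtain ⟨R, hR⟩ := hC.isCompact.isBounded.subset_closedBall 0
  obtain ⟨r, hr, hrρ⟩ := ((frequently_lt_of_liminf_lt (h := h)).and_eventually
    (eventually_ge_atTop (ρ + R))).exists
  have hsum : ∑' a : A, volume (((a : Euc d) +ᵥ C) ∩ closedBall 0 r) ≠ ⊤ := by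
    intro htop
    rw [ballDensity, htop, ENNReal.top_div_of_ne_top measure_closedBall_lt_top.ne] at hr
    exact hr.ne rfl
  refine ((ENNReal.finite_const_le_of_tsum_ne_top hsum hC.volume_pos.ne').image
    Subtype.val).subset ?_
  rintro x ⟨hxA, hx⟩
  refine ⟨⟨x, hxA⟩, ?_, rfl⟩
  rw [Set.mem_ofPred_eq, Set.inter_eq_left.2 (vadd_subset_closedBall hR hx hrρ), measure_vadd]

/-- A thin covering yields a dense packing. Choose a maximal `T ⊆ A` for which `(1 - l) • C + T` is
a packing. For every other `a ∈ A` the translate `C + a` has a translate of `l • C` in common with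
a single translate of the subarrangement `C + T`, so it contributes at most the fraction `1 - l ^ d`
of its volume to the covering. Hence a thin covering has few such `a`. -/
theorem le_packingDensity_of_isCovering (hC : IsBody C) {A : Set (Euc d)} (hA : IsCovering C A)
    {l ε M : ℝ} (hl : 0 < l) (hl1 : l < 1)
    (hε : lowerDensity C A < ENNReal.ofReal (1 + ε))
    (hM : M < (1 - l) ^ d * (1 + ε - ε / l ^ d)) :
    ENNReal.ofReal M ≤ packingDensity C := by
  classical
  have hl' : 0 < 1 - l := by linarith
  have hK : IsBody ((1 - l) • C) := hC.smul hl'.ne'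
  have hfin := finite_inter_closedBall_of_lowerDensity_ne_top hC (hε.trans ENNReal.ofReal_lt_top)
  obtain ⟨R, hR0, hR⟩ := (hC.isCompact.union hK.isCompact).isBounded.subset_closedBall_lt 0 0
  have hRC : C ⊆ closedBall 0 R := fun x hx => hR (Or.inl hx)
  have hRK : (1 - l) • C ⊆ closedBall 0 R := fun x hx => hR (Or.inr hx)
  obtain ⟨T, hTA, hT, hmax⟩ := exists_maximal_pairwise A
    (fun a b : Euc d => Disjoint (interior (a +ᵥ (1 - l) • C)) (interior (b +ᵥ (1 - l) • C)))
    ⟨fun _ _ h => h.symm⟩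
  have hpack : IsPacking ((1 - l) • C) T := by
    -- If `T` were finite, then `A` would be bounded, as each of its points is close to `T`.
    refine ⟨⟨fun hTfin => ?_, hA.discrete.mono hTA⟩, hT⟩
    obtain ⟨ρ, hρ⟩ := hTfin.isBounded.subset_closedBall 0
    refine hA.infinite ((hfin (ρ + R + R)).subset fun x hx => ⟨hx, ?_⟩)
    by_cases hxT : x ∈ T
    · exact closedBall_subset_closedBall (by linarith) (hρ hxT)
    · obtain ⟨y, hy, h⟩ := hmax x hx hxT
      obtain ⟨z, h1, h2⟩ := Set.not_disjoint_iff.1 h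
      exact mem_closedBall_of_vadd_inter_nonempty hRK
        ⟨z, interior_subset h1, vadd_subset_closedBall hRK (hρ hy) le_rfl (interior_subset h2)⟩
        le_rfl
  have hwaste : ∀ x ∈ A, x ∉ T →
      volume.real ((x +ᵥ C) \ ⋃ y ∈ T, (y +ᵥ C)) ≤ (1 - l ^ d) * volume.real C := by
    intro x hx hxT
    obtain ⟨y, hy, h⟩ := hmax x hx hxT
    obtain ⟨z, h1, h2⟩ := Set.not_disjoint_iff.1 h
    have hsub : ∀ w : Euc d, z ∈ w +ᵥ (1 - l) • C → z +ᵥ l • C ⊆ w +ᵥ C := by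
      rintro w ⟨u, hu, rfl⟩ _ ⟨v, hv, rfl⟩
      have huv := Set.add_mem_add hu hv
      rw [← hC.convex.add_smul hl'.le hl.le, sub_add_cancel, one_smul] at huv
      exact ⟨u + v, huv, by simp only [vadd_eq_add, add_assoc]⟩
    calc volume.real ((x +ᵥ C) \ ⋃ y ∈ T, (y +ᵥ C))
        ≤ volume.real ((x +ᵥ C) \ (z +ᵥ l • C)) :=
          measureReal_mono (Set.sdiff_subset_sdiff_right
            ((hsub y (interior_subset h2)).trans
              (Set.subset_biUnion_of_mem (u := fun y => y +ᵥ C) hy)))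
            (measure_ne_top_of_subset Set.sdiff_subset (hC.vadd x).volume_ne_top)
      _ = (1 - l ^ d) * volume.real C := by
          rw [measureReal_sdiff (hsub x (interior_subset h1))
            ((hC.isCompact.smul l).vadd z).measurableSet
            (hC.vadd x).volume_ne_top, real_volume_vadd, real_volume_vadd, real_volume_smul,
            abs_of_pos hl]
          ring
  refine le_trans ?_ (le_iSup₂ (f := fun A (_ : IsPacking C A) => upperDensity C A) _
    (hpack.inv_smul hl'.ne'))
  refine le_limsup_of_frequently_le'
    (frequently_ballDensity_inv_smul hl' (p := fun y => ENNReal.ofReal M ≤ y) ?_)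
  have hlim : Tendsto (fun r : ℝ => (1 - l) ^ d *
      (((1 + -(2 * R) / r) ^ d - (1 - l ^ d) * (1 + ε)) / l ^ d)) atTop
      (nhds ((1 - l) ^ d * ((1 - (1 - l ^ d) * (1 + ε)) / l ^ d))) :=
    (((tendsto_one_add_div_pow (-(2 * R)) d).sub_const _).div_const _).const_mul _
  have hld : 0 < l ^ d := pow_pos hl d
  have hM' : M < (1 - l) ^ d * ((1 - (1 - l ^ d) * (1 + ε)) / l ^ d) := by
    convert hM using 2
    field_simp
    ring
  refine ((frequently_lt_of_liminf_lt (h := hε)).and_eventually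
    ((hlim.eventually_const_lt hM').and (eventually_gt_atTop (2 * R)))).mono ?_
  rintro r ⟨hdens, hrM, hrR⟩
  have hr0 : 0 < r := by linarith
  -- Translates centered in the ball of radius `r - R` lie in the ball of radius `r`, and they cover
  -- the ball of radius `r - 2 * R`.
  set H := (hfin (r - R)).toFinset with hH
  have hmemH : ∀ x, x ∈ H ↔ x ∈ A ∧ x ∈ closedBall 0 (r - R) := fun x => (hfin _).mem_toFinset
  set F := H.filter (· ∈ T) with hF
  set G := H.filter (· ∉ T) with hG
  have hcard : (H.card : ℝ) = F.card + G.card := by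
    exact_mod_cast (Finset.card_filter_add_card_filter_not (s := H) (· ∈ T)).symm
  have hHε := card_lt_of_ballDensity_lt (F := H) hr0 hC.volume_ne_top
    (fun x hx => ((hmemH x).1 hx).1)
    (fun x hx => vadd_subset_closedBall hRC ((hmemH x).1 hx).2 (by linarith)) hdens
  have hcover : closedBall (0 : Euc d) (r + -(2 * R)) ⊆
      (⋃ x ∈ F, (x +ᵥ C)) ∪ ⋃ x ∈ G, ((x +ᵥ C) \ ⋃ y ∈ T, (y +ᵥ C)) := by
    have hcenter : ∀ z ∈ closedBall (0 : Euc d) (r + -(2 * R)), ∀ x ∈ A, z ∈ x +ᵥ C → x ∈ H :=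
      fun z hz x hx hzx => (hmemH x).2
        ⟨hx, mem_closedBall_of_vadd_inter_nonempty hRC ⟨z, hzx, hz⟩ (by linarith)⟩
    intro z hz
    by_cases hzT : z ∈ ⋃ y ∈ T, (y +ᵥ C)
    · obtain ⟨y, hy, hzy⟩ := Set.mem_iUnion₂.1 hzT
      exact Or.inl (Set.mem_iUnion₂.2
        ⟨y, Finset.mem_filter.2 ⟨hcenter z hz y (hTA hy) hzy, hy⟩, hzy⟩)
    · obtain ⟨c, hc, x, hx, hcx⟩ := Set.mem_add.1 (hA.cover.symm ▸ Set.mem_univ z : z ∈ C + A)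
      have hzx : z ∈ x +ᵥ C := ⟨c, hc, by simp only [vadd_eq_add]; rw [← hcx, add_comm]⟩
      have hxT : x ∉ T := fun hxT => hzT (Set.mem_iUnion₂.2 ⟨x, hxT, hzx⟩)
      exact Or.inr (Set.mem_iUnion₂.2
        ⟨x, Finset.mem_filter.2 ⟨hcenter z hz x hx hzx, hxT⟩, hzx, hzT⟩)
  have hWcover : volume.real (closedBall (0 : Euc d) (r + -(2 * R)))
      ≤ F.card * volume.real C + G.card * ((1 - l ^ d) * volume.real C) := by
    have hFle : volume.real (⋃ x ∈ F, (x +ᵥ C)) ≤ F.card * volume.real C := by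
      refine (measureReal_biUnion_finset_le _ _).trans ?_
      simp_rw [real_volume_vadd, Finset.sum_const, nsmul_eq_mul, le_refl]
    have hGle : volume.real (⋃ x ∈ G, ((x +ᵥ C) \ ⋃ y ∈ T, (y +ᵥ C)))
        ≤ G.card * ((1 - l ^ d) * volume.real C) := by
      refine (measureReal_biUnion_finset_le _ _).trans ?_
      rw [← nsmul_eq_mul]
      refine Finset.sum_le_card_nsmul _ _ _ fun x hx => ?_
      obtain ⟨h1, h2⟩ := Finset.mem_filter.1 hx
      exact hwaste x ((hmemH x).1 h1).1 h2
    refine (measureReal_mono hcover ?_).trans ((measureReal_union_le _ _).trans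
      (add_le_add hFle hGle))
    refine ((measure_mono (t := closedBall (0 : Euc d) r) ?_).trans_lt
      measure_closedBall_lt_top).ne
    have hin : ∀ x ∈ H, x +ᵥ C ⊆ closedBall 0 r := fun x hx =>
      vadd_subset_closedBall hRC ((hmemH x).1 hx).2 (by linarith)
    exact Set.union_subset
      (Set.iUnion₂_subset fun x hx => hin x (Finset.mem_filter.1 hx).1)
      (Set.iUnion₂_subset fun x hx => Set.sdiff_subset.trans (hin x (Finset.mem_filter.1 hx).1))
  rw [real_volume_closedBall_add hr0 (by linarith)] at hWcover
  have hW := real_volume_closedBall_pos (d := d) hr0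
  have hV : 0 < volume.real C := hC.real_volume_pos
  refine le_ballDensity_of_card (F := F) hr0 hK.volume_ne_top
    (fun x hx => (Finset.mem_filter.1 hx).2)
    (fun x hx => vadd_subset_closedBall hRK
      ((hmemH x).1 (Finset.mem_filter.1 hx).1).2 (by linarith)) ?_
  rw [real_volume_smul, abs_of_pos hl']
  set W := volume.real (closedBall (0 : Euc d) r)
  set V := volume.real C
  have hld1 : 0 ≤ 1 - l ^ d := sub_nonneg.2 (pow_le_one₀ hl.le hl1.le)
  rw [hcard] at hHε
  -- Eliminate `G.card` between the volume bound from the covering and that from its thinness.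
  have hF' : ((1 + -(2 * R) / r) ^ d - (1 - l ^ d) * (1 + ε)) * W ≤ F.card * V * l ^ d := by
    have := mul_le_mul_of_nonneg_left hHε.le hld1
    linarith
  calc M * W
      ≤ (1 - l) ^ d * (((1 + -(2 * R) / r) ^ d - (1 - l ^ d) * (1 + ε)) / l ^ d) * W := by gcongr
    _ = (1 - l) ^ d * ((((1 + -(2 * R) / r) ^ d - (1 - l ^ d) * (1 + ε)) * W) / l ^ d) := by ring
    _ ≤ (1 - l) ^ d * (F.card * V * l ^ d / l ^ d) := by gcongr
    _ = F.card * ((1 - l) ^ d * V) := by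
      field_simp

/-! ### Choice of the scale -/

/-- The bound of `coveringDensity_le_of_isPacking` in terms of `δ_T(C)`, for an arbitrary scale `l`.
The number `m` measures the asymmetry of `C`: it may be `1` for symmetric bodies and `d` in general. -/
theorem coveringDensity_lt_of_lt_packingDensity (hC : IsBody C) {l m ε M : ℝ} {s : Euc d}
    (hl : 0 < l) (hl1 : l ≤ 1) (hm : 0 ≤ m) (hlm : l * m ≤ 1) (hs : ∀ y ∈ C, s - y ∈ m • C)
    (hε : ENNReal.ofReal (1 - ε) < packingDensity C) (hM0 : 0 < M)
    (hM : (1 + l) ^ d * (1 - ε + ε / l ^ d) < M) :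
    coveringDensity C < ENNReal.ofReal M := by
  obtain ⟨c, hc⟩ := hC.nonempty_interior.mono interior_subset
  obtain ⟨t, ht⟩ := hC.convex.exists_add_smul_sub_smul_mem hc hl.le hm hlm hs
  obtain ⟨A, hA⟩ := lt_iSup_iff.1 hε
  obtain ⟨hA, hdens⟩ := lt_iSup_iff.1 hA
  obtain ⟨M', h1, h2⟩ := exists_between hM
  refine (coveringDensity_le_of_isPacking hC hA hl hl1 ht hdens (M := M') ?_).trans_lt
    ((ENNReal.ofReal_lt_ofReal_iff hM0).2 h2)
  rwa [sub_sub_cancel]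

theorem lt_packingDensity_of_coveringDensity_lt (hC : IsBody C) {l ε M : ℝ}
    (hl : 0 < l) (hl1 : l < 1) (hε : coveringDensity C < ENNReal.ofReal (1 + ε)) (hM0 : 0 ≤ M)
    (hM : M < (1 - l) ^ d * (1 + ε - ε / l ^ d)) :
    ENNReal.ofReal M < packingDensity C := by
  obtain ⟨A, hA⟩ := iInf_lt_iff.1 hε
  obtain ⟨hA, hdens⟩ := iInf_lt_iff.1 hA
  obtain ⟨M', h1, h2⟩ := exists_between hM
  exact ((ENNReal.ofReal_lt_ofReal_iff (hM0.trans_lt h1)).2 h1).trans_le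
    (le_packingDensity_of_isCovering hC hA hl hl1 hdens h2)

theorem rpow_one_div_succ_pow_succ {ε : ℝ} (hε : 0 ≤ ε) (d : ℕ) :
    (ε ^ (1 / ((d : ℝ) + 1))) ^ (d + 1) = ε := by
  have := Real.rpow_inv_natCast_pow hε (Nat.succ_ne_zero d)
  rwa [Nat.cast_succ, ← one_div] at this

/-- With the scale `l ^ (d + 1) = ε` the density `1 - ε + ε / l ^ d` equals
`1 + l - l ^ (d + 1)`, which is less than `1 + l`. -/
theorem coveringDensity_lt_one_add_rpow (hC : IsBody C) {m ε : ℝ} {s : Euc d}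
    (hε0 : 0 < ε) (hε1 : ε < 1) (hm : 0 ≤ m) (hεm : ε ^ (1 / ((d : ℝ) + 1)) * m ≤ 1)
    (hs : ∀ y ∈ C, s - y ∈ m • C) (hε : ENNReal.ofReal (1 - ε) < packingDensity C) :
    coveringDensity C < ENNReal.ofReal ((1 + ε ^ (1 / ((d : ℝ) + 1))) ^ (d + 1)) := by
  have hpow := rpow_one_div_succ_pow_succ hε0.le d
  have hl : 0 < ε ^ (1 / ((d : ℝ) + 1)) := Real.rpow_pos_of_pos hε0 _
  have hl1 : ε ^ (1 / ((d : ℝ) + 1)) ≤ 1 := Real.rpow_le_one hε0.le hε1.le (by positivity)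
  set l := ε ^ (1 / ((d : ℝ) + 1))
  refine coveringDensity_lt_of_lt_packingDensity hC hl hl1 hm hεm hs hε (by positivity) ?_
  have hquot : ε / l ^ d = l := by
    rw [← hpow, pow_succ]
    field_simp
  rw [hquot, pow_succ]
  gcongr
  linarith

end Main

theorem theorem1p2 (d : ℕ) (hd : 2 ≤ d) (C : Set (Euc d)) (hC : IsBody C) :
    -- (1a)
    (∀ ε : ℝ,
      ((0 < ε ∧ ε ≤ 1 / (d : ℝ) ^ (d + 1)) ∨ (0 < ε ∧ ε < 1 ∧ IsCentrallySymmetric C)) →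
      ENNReal.ofReal (1 - ε) < packingDensity C →
      coveringDensity C < ENNReal.ofReal ((1 + ε ^ (1 / ((d : ℝ) + 1))) ^ (d + 1))) ∧
    -- (1b)
    (∀ ε : ℝ, 1 / (d : ℝ) ^ (d + 1) < ε → ε < 1 → ¬ IsCentrallySymmetric C →
      ENNReal.ofReal (1 - ε) < packingDensity C →
      coveringDensity C < ENNReal.ofReal ((1 + ε * (d : ℝ) ^ d) * (1 + 1 / (d : ℝ)) ^ d)) ∧
    -- (2)
    (∀ ε : ℝ, 0 < ε → ε < 1 →
      coveringDensity C < ENNReal.ofReal (1 + ε) →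
      ENNReal.ofReal ((1 - ε ^ (1 / ((d : ℝ) + 1))) ^ (d + 1)) < packingDensity C) := by
  have hd1 : (1 : ℝ) < d := by exact_mod_cast hd
  have hd0 : (0 : ℝ) < d := by linarith
  refine ⟨?_, ?_, ?_⟩
  · rintro ε (⟨hε0, hεd⟩ | ⟨hε0, hε1, c, hc⟩) hε
    · obtain ⟨s, hs⟩ := exists_sub_mem_natCast_smul hC
      have hε1 : ε < 1 := by
        refine hεd.trans_lt ?_
        rw [div_lt_one (by positivity)]
        exact one_lt_pow₀ hd1 (Nat.succ_ne_zero d)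
      refine coveringDensity_lt_one_add_rpow hC hε0 hε1 hd0.le ?_ hs hε
      refine (pow_le_one_iff_of_nonneg (by positivity) (Nat.succ_ne_zero d)).1 ?_
      rw [mul_pow, Nat.succ_eq_add_one, rpow_one_div_succ_pow_succ hε0.le]
      rwa [le_div_iff₀ (by positivity)] at hεd
    · refine coveringDensity_lt_one_add_rpow hC (m := 1) (s := c + c) hε0 hε1 zero_le_one ?_
        (fun y hy => ?_) hε
      · rw [mul_one]
        exact Real.rpow_le_one hε0.le hε1.le (by positivity)
      · rw [one_smul, ← hc]
        refine ⟨y, hy, ?_⟩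
        rw [Equiv.pointReflection_apply, vsub_eq_sub, vadd_eq_add]
        abel
  · intro ε hεd hε1 _ hε
    obtain ⟨s, hs⟩ := exists_sub_mem_natCast_smul hC
    have hε0 : 0 < ε := lt_trans (by positivity) hεd
    refine coveringDensity_lt_of_lt_packingDensity hC (l := 1 / d) (by positivity)
      ((div_le_one hd0).2 hd1.le) hd0.le (one_div_mul_cancel hd0.ne').le hs hε (by positivity) ?_
    rw [mul_comm, one_div_pow, div_div_eq_mul_div, div_one]
    gcongr
    linarith
  · intro ε hε0 hε1 hε
    have hpow := rpow_one_div_succ_pow_succ hε0.le d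
    have hl : 0 < ε ^ (1 / ((d : ℝ) + 1)) := Real.rpow_pos_of_pos hε0 _
    have hl1 : ε ^ (1 / ((d : ℝ) + 1)) < 1 := Real.rpow_lt_one hε0.le hε1 (by positivity)
    set l := ε ^ (1 / ((d : ℝ) + 1))
    have hl' : 0 < 1 - l := by linarith
    refine lt_packingDensity_of_coveringDensity_lt hC hl hl1 hε (by positivity) ?_
    have hquot : ε / l ^ d = l := by
      rw [← hpow, pow_succ]
      field_simp
    rw [hquot, pow_succ]
    gcongr
    linarith
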